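/- For $\alpha\in\mathbb R$ let $D_\alpha$ be the space of analytic functions $f(z)=\sum_{k\ge 0}a_kz^k$ on the open unit disk $\mathbb D$ with $\|f\|_\alpha^2=\sum_{k\ge0}(k+1)^\alpha|a_k|^2<\infty$, with inner product $\langle f,g\rangle_\alpha=\sum_{k\ge0}(k+1)^\alpha a_k\overline{b_k}$ for $g(z)=\sum_{k\ge 0} b_kz^k$; $D_{-1}$ is the Bergman space. A function $f\in D_\alpha$ is cyclic if the closed linear span of $\{z^kf:k\ge0\}$ is $D_\alpha$. An optimal approximant of order $n$ to $1/f$ in $D_\alpha$ is a polynomial $p$ of degree at most $n$ that minimizes $\|pf-1\|_\alpha$ among all polynomials of degree at most $n$. Let $f(z)=(1+z)/(1-z)^{4/5}$, with the principal branch of the power. Then $f$ belongs to the Bergman space $D_{-1}$ and is cyclic there; $zf\in D_{-1}$, and $$\|zf\|_{-1}^2=\frac{2142}{125}\,\frac{\Gamma(2/5)}{\Gamma(16/5)^2},\qquad \langle f,zf\rangle_{-1}=9\,\frac{\Gamma(7/5)}{\Gamma(11/5)^2}.$$ There is exactly one optimal approximant $p_1$ of order $1$ to $1/f$ in $D_{-1}$,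 and its zero set in $\mathbb C$ is $$\{z\in\mathbb C: p_1(z)=0\}=\left\{\tfrac{119}{121}\right\}.$$ In particular $p_1$ vanishes at the point $119/121$ of the open unit disk, where $f$ does not vanish, so that this zero is extraneous. -/

import Mathlib

open scoped Nat ComplexConjugate

noncomputable section

namespace DirichletType

/-- The `k`-th Taylor coefficient of `f` at the origin. -/
def coeff (f : ℂ → ℂ) (k : ℕ) : ℂ := iteratedDeriv k f 0 / (k ! : ℂ)

/-- The Dirichlet-type space `D_α`: functions that are analytic on the open unit disk and whose
Taylor coefficients satisfy `∑ (k + 1) ^ α * |a_k| ^ 2 < ∞`. Only the values on the disk matter;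
`α = -1` gives the Bergman space. -/
def space (α : ℝ) : Set (ℂ → ℂ) :=
  {f | DifferentiableOn ℂ f (Metric.ball 0 1) ∧
    Summable fun k : ℕ => ((k : ℝ) + 1) ^ α * ‖coeff f k‖ ^ 2}

/-- The norm of `D_α`, meaningful for members of `D_α`. -/
def dnorm (α : ℝ) (f : ℂ → ℂ) : ℝ :=
  √(∑' k : ℕ, ((k : ℝ) + 1) ^ α * ‖coeff f k‖ ^ 2)

/-- The inner product of `D_α`, linear in the first argument, meaningful for members of `D_α`. -/
def dinner (α : ℝ) (f g : ℂ → ℂ) : ℂ :=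
  ∑' k : ℕ, ((((k : ℝ) + 1) ^ α : ℝ) : ℂ) * coeff f k * conj (coeff g k)

/-- The closed subspace `[f]` of `D_α` generated by the functions `z ^ k * f`, `k = 0, 1, 2, …`:
the members of `D_α` that lie in the norm closure of their linear span. -/
def generated (α : ℝ) (f : ℂ → ℂ) : Set (ℂ → ℂ) :=
  {g | g ∈ space α ∧ ∀ ε : ℝ, 0 < ε →
    ∃ h ∈ Submodule.span ℂ (Set.range fun (k : ℕ) (z : ℂ) => z ^ k * f z),
      dnorm α (g - h) < ε}

/-- `f` is cyclic in `D_α`: `f ∈ D_α` and `[f] = D_α`. -/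
def IsCyclic (α : ℝ) (f : ℂ → ℂ) : Prop :=
  f ∈ space α ∧ generated α f = space α

/-- `p` is an optimal approximant of order `n` to `1 / f` in `D_α`: among all polynomials of degree
at most `n` it minimizes `‖p f - 1‖_α`. -/
def IsOptimalApproximant (α : ℝ) (f : ℂ → ℂ) (n : ℕ) (p : Polynomial ℂ) : Prop :=
  f ∈ space α ∧ p.natDegree ≤ n ∧ ∀ q : Polynomial ℂ, q.natDegree ≤ n →
    dnorm α (fun z => p.eval z * f z - 1) ≤ dnorm α (fun z => q.eval z * f z - 1)

/-- The function `(1 + z) / (1 - z) ^ (4 / 5)`, with the principal branch of the power (on the unit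
disk `1 - z` lies in the right half-plane). -/
def bergmanExample (z : ℂ) : ℂ := (1 + z) / (1 - z) ^ (4 / 5 : ℂ)

end DirichletType

end

/-!
Write `g = (1 - z) ^ (-a)`, so that `f = (1 + z) g` with `a = 4 / 5`.

The Taylor coefficients of `1 / g` are absolutely summable, and powers of the shift contract
`D_α` for `α ≤ 0`; hence the series of `1 / g` can be applied to `(1 - ζ z) g` and puts `1 - ζ z`
into its closed invariant subspace. For `α < 0` and `‖ζ‖ ≤ 1` the powers `ζ ^ k z ^ k` tend to `0`
in norm, so `1` lies in the closed invariant subspace of `1 - ζ z`, and `(1 - ζ z) g` is cyclic.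

Gauss's summation of `₂F₁` at `1` gives `‖g‖²` in the Bergman space, and telescoping sums express
`‖z ^ n g‖²` and `⟨z ^ n g, z ^ m g⟩` through it. Orthogonality of `1 - p f` to `z f`, together with
`⟨z f, 1⟩ = 0`, shows that the zero of the optimal approximant `p` of order `1` is
`‖z f‖² / ⟨f, z f⟩`.
-/

open Filter Topology Asymptotics

noncomputable section

theorem tsum_succ_sub_eq_of_tendsto {E : Type*} [AddCommGroup E] [TopologicalSpace E]
    [IsTopologicalAddGroup E] [T2Space E] {v : ℕ → E} {l : E} (hv : Tendsto v atTop (𝓝 l))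
    (hs : Summable fun k => v (k + 1) - v k) : ∑' k, (v (k + 1) - v k) = l - v 0 := by
  refine tendsto_nhds_unique hs.hasSum.tendsto_sum_nat ?_
  simpa only [Finset.sum_range_sub] using hv.sub_const (v 0)

section GammaAsymptotics

theorem tendsto_inv_GammaSeq (s : ℂ) :
    Tendsto (fun n => (Complex.GammaSeq s n)⁻¹) atTop (𝓝 (Complex.Gamma s)⁻¹) := by
  by_cases h : ∀ m : ℕ, s ≠ -m
  · exact (Complex.GammaSeq_tendsto_Gamma s).inv₀ (Complex.Gamma_ne_zero h)
  · -- At a pole both `GammaSeq` (eventually) and `Gamma` take the junk value `0 = 0⁻¹`.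
    push Not at h
    obtain ⟨m, rfl⟩ := h
    rw [Complex.Gamma_neg_nat_eq_zero]
    refine tendsto_const_nhds.congr' ?_
    filter_upwards [eventually_ge_atTop m] with n hn
    rw [Complex.GammaSeq, Finset.prod_eq_zero (Finset.mem_range.2 (Nat.lt_succ_of_le hn))
      (neg_add_cancel _), div_zero]

theorem ascPochhammer_eval_eq_prod_range {R : Type*} [CommSemiring R] (n : ℕ) (r : R) :
    (ascPochhammer R n).eval r = ∏ j ∈ Finset.range n, (r + j) := by
  induction n with
  | zero => simp
  | succ n ih => rw [ascPochhammer_succ_eval, ih, Finset.prod_range_succ]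

theorem ascPochhammer_succ_eval_eq_inv_GammaSeq (s : ℂ) {n : ℕ} (hn : n ≠ 0) :
    (ascPochhammer ℂ (n + 1)).eval s = (n : ℂ) ^ s * n ! * (Complex.GammaSeq s n)⁻¹ := by
  have hpow : (n : ℂ) ^ s ≠ 0 := by simp [Complex.cpow_eq_zero_iff, hn]
  have hfact : (n ! : ℂ) ≠ 0 := Nat.cast_ne_zero.2 n.factorial_ne_zero
  rw [Complex.GammaSeq, inv_div, ascPochhammer_eval_eq_prod_range]
  field_simp

theorem isBigO_natCast_cpow (s : ℂ) :
    (fun n : ℕ => (n : ℂ) ^ s) =O[atTop] fun n : ℕ => (n : ℝ) ^ s.re := by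
  refine IsBigO.of_norm_eventuallyLE ?_
  filter_upwards [eventually_gt_atTop 0] with n hn
  rw [Complex.norm_natCast_cpow_of_pos hn]

theorem isBigO_inv_natCast_succ :
    (fun n : ℕ => ((n : ℂ) + 1)⁻¹) =O[atTop] fun n : ℕ => (n : ℝ)⁻¹ := by
  refine IsBigO.of_norm_eventuallyLE ?_
  filter_upwards [eventually_gt_atTop 0] with n hn
  rw [← Nat.cast_succ, norm_inv, Complex.norm_natCast, Nat.cast_succ]
  gcongr
  linarith

end GammaAsymptotics

section Multichoose

theorem multichoose_eq_ascPochhammer_div_factorial {K : Type*} [Field K] [CharZero K] (a : K)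
    (k : ℕ) : Ring.multichoose a k = (ascPochhammer K k).eval a / k ! := by
  have h := Ring.factorial_nsmul_multichoose_eq_ascPochhammer a k
  rw [Polynomial.ascPochhammer_smeval_eq_eval, nsmul_eq_mul] at h
  rw [eq_div_iff (Nat.cast_ne_zero.2 k.factorial_ne_zero), mul_comm, h]

theorem multichoose_succ {K : Type*} [Field K] [CharZero K] (a : K) (k : ℕ) :
    Ring.multichoose a (k + 1) = Ring.multichoose a k * (a + k) / (k + 1) := by
  rw [multichoose_eq_ascPochhammer_div_factorial, multichoose_eq_ascPochhammer_div_factorial,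
    ascPochhammer_succ_eval, Nat.factorial_succ]
  have := k.cast_add_one_ne_zero (R := K)
  push_cast
  field_simp

theorem isBigO_multichoose_succ (a : ℂ) :
    (fun k : ℕ => Ring.multichoose a (k + 1)) =O[atTop] fun k : ℕ => (k : ℝ) ^ (a.re - 1) := by
  refine (((isBigO_natCast_cpow a).mul isBigO_inv_natCast_succ).mul
    ((tendsto_inv_GammaSeq a).isBigO_one ℝ)).congr' ?_ ?_
  · filter_upwards [eventually_ne_atTop 0] with k hk
    rw [multichoose_eq_ascPochhammer_div_factorial,
      ascPochhammer_succ_eval_eq_inv_GammaSeq a hk, Nat.factorial_succ]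
    push_cast
    have := Nat.cast_ne_zero (R := ℂ).2 k.factorial_ne_zero
    field_simp
  · filter_upwards [eventually_ne_atTop 0] with k hk
    rw [Real.rpow_sub_one (Nat.cast_ne_zero.2 hk), mul_one, div_eq_mul_inv]

theorem tendsto_multichoose_zero {a : ℂ} (ha : a.re < 1) :
    Tendsto (fun k => Ring.multichoose a k) atTop (𝓝 0) := by
  refine (tendsto_add_atTop_iff_nat 1).1 ((isBigO_multichoose_succ a).trans_tendsto ?_)
  rw [← neg_sub]
  exact (tendsto_rpow_neg_atTop (sub_pos.2 ha)).comp tendsto_natCast_atTop_atTop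

theorem summable_norm_multichoose {a : ℂ} (ha : a.re < 0) :
    Summable fun k => ‖Ring.multichoose a k‖ := by
  refine (summable_nat_add_iff 1).1 (summable_of_isBigO_nat (Real.summable_nat_rpow.2 ?_)
    (isBigO_multichoose_succ a).norm_left)
  linarith

end Multichoose

section Gauss

variable {a b c : ℂ}

local notation "t" => ordinaryHypergeometricCoefficient

theorem ordinaryHypergeometricCoefficient_succ (a b c : ℂ) (k : ℕ) :
    t a b c (k + 1) = t a b c k * ((a + k) * (b + k) / ((k + 1) * (c + k))) := by
  simp only [ordinaryHypergeometricCoefficient, ascPochhammer_succ_eval, Nat.factorial_succ,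
    Nat.cast_mul, Nat.cast_succ, mul_inv, div_eq_mul_inv]
  ring

theorem ordinaryHypergeometricCoefficient_add_one (a b : ℂ) (hc : ∀ m : ℕ, c ≠ -m) (k : ℕ) :
    t a b (c + 1) k = t a b c k * (c / (c + k)) := by
  have hadd (m : ℕ) : c + m ≠ 0 := fun h => hc m (eq_neg_of_add_eq_zero_left h)
  have hc0 : c ≠ 0 := by simpa using hc 0
  induction k with
  | zero => simp [hc0]
  | succ k ih =>
    have h₀ := hadd k
    have h₁ : c + 1 + k ≠ 0 := fun h => hadd (k + 1) (by push_cast; linear_combination h)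
    rw [ordinaryHypergeometricCoefficient_succ, ordinaryHypergeometricCoefficient_succ, ih,
      Nat.cast_succ, show c + (k + 1) = c + 1 + k by ring]
    field_simp

theorem isBigO_ordinaryHypergeometricCoefficient_succ (a b c : ℂ) :
    (fun k : ℕ => t a b c (k + 1)) =O[atTop] fun k : ℕ => (k : ℝ) ^ (-(c - a - b).re - 1) := by
  refine (((isBigO_natCast_cpow (-(c - a - b))).mul isBigO_inv_natCast_succ).mul
    ((((tendsto_inv_GammaSeq a).mul (tendsto_inv_GammaSeq b)).mul
      (Complex.GammaSeq_tendsto_Gamma c)).isBigO_one ℝ)).congr' ?_ ?_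
  · filter_upwards [eventually_ne_atTop 0] with k hk
    have hk' : (k : ℂ) ≠ 0 := Nat.cast_ne_zero.2 hk
    have hfact := Nat.cast_ne_zero (R := ℂ).2 k.factorial_ne_zero
    have hpow : (k : ℂ) ^ (-(c - a - b)) = (k : ℂ) ^ a * (k : ℂ) ^ b * ((k : ℂ) ^ c)⁻¹ := by
      rw [← Complex.cpow_neg, ← Complex.cpow_add _ _ hk', ← Complex.cpow_add _ _ hk']
      ring_nf
    simp only [ordinaryHypergeometricCoefficient, ascPochhammer_succ_eval_eq_inv_GammaSeq _ hk,
      hpow, Nat.factorial_succ, Nat.cast_mul, Nat.cast_succ, mul_inv, inv_inv]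
    field_simp
  · filter_upwards [eventually_ne_atTop 0] with k hk
    rw [Real.rpow_sub_one (Nat.cast_ne_zero.2 hk), mul_one, div_eq_mul_inv, Complex.neg_re]

theorem summable_ordinaryHypergeometricCoefficient (h : 0 < (c - a - b).re) :
    Summable (t a b c) := by
  refine (summable_nat_add_iff 1).1 (summable_of_isBigO_nat (Real.summable_nat_rpow.2 ?_)
    (isBigO_ordinaryHypergeometricCoefficient_succ a b c))
  linarith

theorem tendsto_mul_ordinaryHypergeometricCoefficient_zero (h : 0 < (c - a - b).re) :
    Tendsto (fun k : ℕ => k * t a b c k) atTop (𝓝 0) := by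
  have hsucc : (fun k : ℕ => ((k + 1 : ℕ) : ℂ)) =O[atTop] fun k : ℕ => (k : ℝ) := by
    refine IsBigO.of_bound 2 ?_
    filter_upwards [eventually_ge_atTop 1] with k hk
    rw [Complex.norm_natCast, Real.norm_natCast]
    exact_mod_cast (by omega : k + 1 ≤ 2 * k)
  refine (tendsto_add_atTop_iff_nat 1).1
    ((hsucc.mul (isBigO_ordinaryHypergeometricCoefficient_succ a b c)).trans_tendsto ?_)
  refine ((tendsto_rpow_neg_atTop h).comp tendsto_natCast_atTop_atTop).congr' ?_
  filter_upwards [eventually_ne_atTop 0] with k hk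
  have hk' : (k : ℝ) ≠ 0 := Nat.cast_ne_zero.2 hk
  rw [Function.comp_apply, Real.rpow_sub_one hk', mul_div_cancel₀ _ hk']

theorem ordinaryHypergeometric_one_eq_tsum (a b c : ℂ) :
    ₂F₁ a b c (1 : ℂ) = ∑' k, t a b c k := by
  simp [ordinaryHypergeometric_eq_tsum]

theorem ordinaryHypergeometric_one_contiguous (h : 0 < (c - a - b).re) (hc : ∀ m : ℕ, c ≠ -m) :
    c * (c - a - b) * ₂F₁ a b c (1 : ℂ) = (c - a) * (c - b) * ₂F₁ a b (c + 1) (1 : ℂ) := by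
  have hs := (summable_ordinaryHypergeometricCoefficient h).mul_left (c * (c - a - b))
  have h' : 0 < (c + 1 - a - b).re := by
    simp only [Complex.sub_re, Complex.add_re, Complex.one_re] at h ⊢
    linarith
  have hs' := (summable_ordinaryHypergeometricCoefficient h').mul_left ((c - a) * (c - b))
  set v : ℕ → ℂ := fun k => -c * (k * t a b c k) with hv
  have htelescope (k : ℕ) : c * (c - a - b) * t a b c k - (c - a) * (c - b) * t a b (c + 1) k =
      v (k + 1) - v k := by
    have hck : c + k ≠ 0 := fun h => hc k (eq_neg_of_add_eq_zero_left h)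
    have hk := k.cast_add_one_ne_zero (R := ℂ)
    simp only [hv, ordinaryHypergeometricCoefficient_add_one a b hc,
      ordinaryHypergeometricCoefficient_succ, Nat.cast_succ]
    field_simp
    ring
  have hlim : Tendsto v atTop (𝓝 0) := by
    simpa only [mul_zero] using
      (tendsto_mul_ordinaryHypergeometricCoefficient_zero h).const_mul (-c)
  have hsum := tsum_succ_sub_eq_of_tendsto hlim ((hs.sub hs').congr htelescope)
  rw [← tsum_congr htelescope, hs.tsum_sub hs', tsum_mul_left, tsum_mul_left] at hsum
  simp only [ordinaryHypergeometric_one_eq_tsum]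
  simpa [hv, sub_eq_zero] using hsum

theorem ascPochhammer_mul_ordinaryHypergeometric_one (h : 0 < (c - a - b).re)
    (hc : ∀ m : ℕ, c ≠ -m) (n : ℕ) :
    (ascPochhammer ℂ n).eval c * (ascPochhammer ℂ n).eval (c - a - b) * ₂F₁ a b c (1 : ℂ) =
      (ascPochhammer ℂ n).eval (c - a) * (ascPochhammer ℂ n).eval (c - b) *
        ₂F₁ a b (c + n) (1 : ℂ) := by
  induction n with
  | zero => simp
  | succ n ih =>
    have hn : 0 < (c + n - a - b).re := by
      simp only [Complex.sub_re, Complex.add_re, Complex.natCast_re] at h ⊢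
      linarith [n.cast_nonneg (α := ℝ)]
    have hcn (m : ℕ) : c + n ≠ -m := fun h => hc (n + m) (by push_cast; linear_combination h)
    have hstep := ordinaryHypergeometric_one_contiguous hn hcn
    simp only [ascPochhammer_succ_eval, Nat.cast_succ, ← add_assoc]
    linear_combination ((c + n) * (c - a - b + n)) * ih +
      (ascPochhammer ℂ n).eval (c - a) * (ascPochhammer ℂ n).eval (c - b) * hstep

theorem norm_ascPochhammer_eval_le_add (hc : 0 ≤ c.re) (n k : ℕ) :
    ‖(ascPochhammer ℂ k).eval c‖ ≤ ‖(ascPochhammer ℂ k).eval (c + n)‖ := by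
  simp only [ascPochhammer_eval_eq_prod_range, norm_prod]
  refine Finset.prod_le_prod (fun _ _ => norm_nonneg _) fun j _ => ?_
  have hre : c.re + j ≤ c.re + n + j := by linarith [n.cast_nonneg (α := ℝ)]
  rw [← sq_le_sq₀ (norm_nonneg _) (norm_nonneg _), Complex.sq_norm, Complex.sq_norm,
    Complex.normSq_apply, Complex.normSq_apply]
  simp only [Complex.add_re, Complex.add_im, Complex.natCast_re, Complex.natCast_im, add_zero]
  gcongr

theorem tendsto_ordinaryHypergeometricCoefficient_add_natCast (a b c : ℂ) (k : ℕ) :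
    Tendsto (fun n : ℕ => t a b (c + n) k) atTop (𝓝 (if k = 0 then 1 else 0)) := by
  have hfactor (j : ℕ) : Tendsto (fun n : ℕ => (c + n + j)⁻¹) atTop (𝓝 0) := by
    have hcast := tendsto_natCast_atTop_cobounded (α := ℂ)
    refine (tendsto_inv₀_cobounded.comp
      ((tendsto_const_add_cobounded (c + j)).comp hcast)).congr fun n => ?_
    simp [add_right_comm]
  have hprod := tendsto_finsetProd (Finset.range k) fun j _ => hfactor j
  simp only [ordinaryHypergeometricCoefficient, ascPochhammer_eval_eq_prod_range _ (c + _),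
    ← Finset.prod_inv_distrib]
  convert hprod.const_mul ((k ! : ℂ)⁻¹ * (ascPochhammer ℂ k).eval a * (ascPochhammer ℂ k).eval b)
    using 2
  rcases k with _ | k <;> simp

theorem tendsto_ordinaryHypergeometric_one_of_re_pos (h : 0 < (c - a - b).re) (hc : 0 < c.re) :
    Tendsto (fun n : ℕ => ₂F₁ a b (c + n) (1 : ℂ)) atTop (𝓝 1) := by
  have hlim := tendsto_tsum_of_dominated_convergence (bound := fun k => ‖t a b c k‖)
    (summable_ordinaryHypergeometricCoefficient h).norm
    (tendsto_ordinaryHypergeometricCoefficient_add_natCast a b c) (.of_forall fun n k => by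
      rw [norm_mul, norm_mul _ (_⁻¹), norm_inv, norm_inv]
      gcongr
      · refine norm_pos_iff.2 fun h0 => ?_
        obtain ⟨m, -, hm⟩ := (ascPochhammer_eval_eq_zero_iff k c).1 h0
        have := congrArg Complex.re hm
        simp only [Complex.natCast_re, Complex.neg_re] at this
        linarith [m.cast_nonneg (α := ℝ)]
      · exact norm_ascPochhammer_eval_le_add hc.le n k)
  simpa [ordinaryHypergeometric_one_eq_tsum] using hlim

theorem tendsto_ordinaryHypergeometric_one (h : 0 < (c - a - b).re) :
    Tendsto (fun n : ℕ => ₂F₁ a b (c + n) (1 : ℂ)) atTop (𝓝 1) := by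
  obtain ⟨N, hN⟩ := exists_nat_gt (-c.re)
  refine (tendsto_add_atTop_iff_nat N).1 ?_
  have hN' : 0 < (c + N - a - b).re := by
    simp only [Complex.sub_re, Complex.add_re, Complex.natCast_re] at h ⊢
    linarith [N.cast_nonneg (α := ℝ)]
  refine (tendsto_ordinaryHypergeometric_one_of_re_pos hN' ?_).congr fun n => ?_
  · simp only [Complex.add_re, Complex.natCast_re]
    linarith
  · rw [add_assoc, ← Nat.cast_add, add_comm N]

theorem ordinaryHypergeometric_one (h : 0 < (c - a - b).re) (hc : ∀ m : ℕ, c ≠ -m) :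
    ₂F₁ a b c (1 : ℂ) = Complex.Gamma c * Complex.Gamma (c - a - b) /
      (Complex.Gamma (c - a) * Complex.Gamma (c - b)) := by
  have hΓ : (Complex.Gamma c)⁻¹ * (Complex.Gamma (c - a - b))⁻¹ * ₂F₁ a b c (1 : ℂ) =
      (Complex.Gamma (c - a))⁻¹ * (Complex.Gamma (c - b))⁻¹ * 1 := by
    refine tendsto_nhds_unique (((tendsto_inv_GammaSeq c).mul
      (tendsto_inv_GammaSeq (c - a - b))).mul_const _) ((((tendsto_inv_GammaSeq (c - a)).mul
      (tendsto_inv_GammaSeq (c - b))).mul ((tendsto_ordinaryHypergeometric_one h).comp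
      (tendsto_add_atTop_nat 1))).congr' ?_)
    filter_upwards [eventually_ne_atTop 0] with n hn
    have hn' : (n : ℂ) ≠ 0 := Nat.cast_ne_zero.2 hn
    have hfact := Nat.cast_ne_zero (R := ℂ).2 n.factorial_ne_zero
    have hpow : (n : ℂ) ^ c * (n : ℂ) ^ (c - a - b) = (n : ℂ) ^ (c - a) * (n : ℂ) ^ (c - b) := by
      rw [← Complex.cpow_add _ _ hn', ← Complex.cpow_add _ _ hn']
      ring_nf
    have hpow0 (s : ℂ) : (n : ℂ) ^ s ≠ 0 := by simp [Complex.cpow_eq_zero_iff, hn]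
    have hprod := ascPochhammer_mul_ordinaryHypergeometric_one h hc (n + 1)
    simp only [ascPochhammer_succ_eval_eq_inv_GammaSeq _ hn] at hprod
    refine mul_left_cancel₀ (mul_ne_zero (mul_ne_zero (hpow0 c) (hpow0 (c - a - b)))
      (mul_ne_zero hfact hfact)) ?_
    rw [Function.comp_apply]
    linear_combination -hprod + (n ! * n !) * (Complex.GammaSeq (c - a) n)⁻¹ *
      (Complex.GammaSeq (c - b) n)⁻¹ * ₂F₁ a b (c + (n + 1 : ℕ)) (1 : ℂ) * hpow
  have h₁ := Complex.Gamma_ne_zero hc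
  have h₂ := Complex.Gamma_ne_zero_of_re_pos h
  rw [mul_one, ← mul_inv, ← mul_inv, inv_mul_eq_iff_eq_mul₀ (mul_ne_zero h₁ h₂)] at hΓ
  rw [hΓ, div_eq_mul_inv]

end Gauss

section BergmanSums

open Complex in
theorem tsum_multichoose_mul_multichoose_div_succ {a b : ℂ} (h : (a + b).re < 2) :
    ∑' k : ℕ, Ring.multichoose a k * Ring.multichoose b k / (k + 1) =
      Gamma (2 - a - b) / (Gamma (2 - a) * Gamma (2 - b)) := by
  have hre : 0 < (2 - a - b).re := by
    simp only [add_re, sub_re, re_ofNat] at h ⊢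
    linarith
  have hc (m : ℕ) : (2 : ℂ) ≠ -m := fun h => by
    have := congrArg re h
    simp only [re_ofNat, neg_re, natCast_re] at this
    linarith [m.cast_nonneg (α := ℝ)]
  have hterm (k : ℕ) : ordinaryHypergeometricCoefficient a b 2 k =
      Ring.multichoose a k * Ring.multichoose b k / (k + 1) := by
    have htwo : (ascPochhammer ℂ k).eval 2 = (k + 1)! := by
      rw [← Nat.cast_ofNat, ascPochhammer_nat_eq_natCast_ascFactorial, add_comm,
        ← Nat.factorial_mul_ascFactorial, Nat.factorial_one, one_mul]
    rw [ordinaryHypergeometricCoefficient, htwo, multichoose_eq_ascPochhammer_div_factorial,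
      multichoose_eq_ascPochhammer_div_factorial, Nat.factorial_succ, Nat.cast_mul, Nat.cast_succ]
    field_simp
  simp_rw [← hterm, ← ordinaryHypergeometric_one_eq_tsum, ordinaryHypergeometric_one hre hc,
    show (2 : ℂ) = (1 : ℕ) + 1 by norm_num, Gamma_nat_eq_factorial, Nat.factorial_one,
    Nat.cast_one, one_mul]

theorem rpow_le_max_one_mul_rpow {x y r : ℝ} (α : ℝ) (hx : 0 < x) (hxy : x ≤ y)
    (hyr : y ≤ r * x) : y ^ α ≤ max 1 (r ^ α) * x ^ α := by
  rcases le_total α 0 with hα | hα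
  · exact (Real.rpow_le_rpow_of_nonpos hx hxy hα).trans
      (le_mul_of_one_le_left (by positivity) (le_max_left _ _))
  · have hr : 0 ≤ r := nonneg_of_mul_nonneg_left ((hx.le.trans hxy).trans hyr) hx
    refine (Real.rpow_le_rpow (hx.le.trans hxy) hyr hα).trans ?_
    rw [Real.mul_rpow hr hx.le]
    gcongr
    exact le_max_right _ _

theorem summable_rpow_mul_norm_multichoose_sq {a : ℂ} {α : ℝ} (h : 2 * a.re < 1 - α) :
    Summable fun k : ℕ => ((k : ℝ) + 1) ^ α * ‖Ring.multichoose a k‖ ^ 2 := by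
  have hweight : (fun k : ℕ => ((k + 1 : ℕ) + 1 : ℝ) ^ α) =O[atTop] fun k : ℕ => (k : ℝ) ^ α := by
    refine IsBigO.of_bound (max 1 (3 ^ α)) ?_
    filter_upwards [eventually_ge_atTop 1] with k hk
    have hk' : (1 : ℝ) ≤ k := Nat.one_le_cast.2 hk
    rw [Real.norm_of_nonneg (by positivity), Real.norm_of_nonneg (by positivity), Nat.cast_succ]
    exact rpow_le_max_one_mul_rpow α (by linarith) (by linarith) (by linarith)
  refine (summable_nat_add_iff 1).1 (summable_of_isBigO_nat
    (g := fun k : ℕ => (k : ℝ) ^ (α + 2 * (a.re - 1))) (Real.summable_nat_rpow.2 (by linarith))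
    ((hweight.mul ((isBigO_multichoose_succ a).norm_left.pow 2)).congr' .rfl ?_))
  filter_upwards [eventually_gt_atTop 0] with k hk
  have hk' : (0 : ℝ) < k := Nat.cast_pos.2 hk
  rw [Real.rpow_add hk', mul_comm 2, Real.rpow_mul hk'.le, Real.rpow_two]

/-- The squared norm of `zⁿ (1 - z) ^ (-a)` in the Bergman space `D₋₁`, for real
`a < 1`. -/
def bergmanNormSq (a : ℝ) (n : ℕ) : ℝ := ∑' k : ℕ, Ring.multichoose a k ^ 2 / (k + n + 1)

variable {a : ℝ}

theorem ofReal_multichoose (a : ℝ) (k : ℕ) :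
    ((Ring.multichoose a k : ℝ) : ℂ) = Ring.multichoose (a : ℂ) k :=
  Ring.map_multichoose Complex.ofRealHom a k

theorem summable_multichoose_sq_div (ha : a < 1) (n : ℕ) :
    Summable fun k : ℕ => Ring.multichoose a k ^ 2 / ((k : ℝ) + n + 1) := by
  refine (summable_rpow_mul_norm_multichoose_sq (a := a) (α := -1) ?_).of_nonneg_of_le
    (fun k => by positivity) fun k => ?_
  · rw [Complex.ofReal_re]
    linarith
  · rw [← ofReal_multichoose, Complex.norm_real, Real.norm_eq_abs, sq_abs, Real.rpow_neg_one,
      mul_comm, ← div_eq_mul_inv]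
    gcongr
    linarith [n.cast_nonneg (α := ℝ)]

theorem bergmanNormSq_zero (ha : a < 1) :
    bergmanNormSq a 0 = Real.Gamma (2 - 2 * a) / Real.Gamma (2 - a) ^ 2 := by
  have h := tsum_multichoose_mul_multichoose_div_succ (a := a) (b := a) (by
    rw [← Complex.ofReal_add, Complex.ofReal_re]
    linarith)
  have hexp : (2 - a - a : ℂ) = (2 - 2 * a : ℝ) := by push_cast; ring
  rw [hexp, ← Complex.ofReal_ofNat, ← Complex.ofReal_sub, Complex.Gamma_ofReal,
    Complex.Gamma_ofReal] at h
  simp only [← ofReal_multichoose] at h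
  rw [bergmanNormSq]
  simp only [sq, Nat.cast_zero, add_zero]
  exact_mod_cast h

theorem bergmanNormSq_succ (ha : a < 1) (n : ℕ) :
    (n + 2 - a) ^ 2 * bergmanNormSq a (n + 1) =
      (n + 1) ^ 2 * bergmanNormSq a n + (1 - a) ^ 2 * bergmanNormSq a 0 := by
  have hs₁ := (summable_multichoose_sq_div ha (n + 1)).mul_left ((n + 2 - a) ^ 2)
  have hs₂ := ((summable_multichoose_sq_div ha n).mul_left ((n + 1 : ℝ) ^ 2)).add
    ((summable_multichoose_sq_div ha 0).mul_left ((1 - a) ^ 2))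
  set v : ℕ → ℝ := fun k => -(n + 1) * (k / (k + n + 1)) * Ring.multichoose a k ^ 2 with hv
  have htelescope (k : ℕ) :
      (n + 2 - a) ^ 2 * (Ring.multichoose a k ^ 2 / (k + (n + 1 : ℕ) + 1)) -
        ((n + 1) ^ 2 * (Ring.multichoose a k ^ 2 / (k + n + 1)) +
          (1 - a) ^ 2 * (Ring.multichoose a k ^ 2 / (k + (0 : ℕ) + 1))) = v (k + 1) - v k := by
    simp only [hv, multichoose_succ]
    push_cast
    field_simp
    ring
  have hbdd : IsBoundedUnder (· ≤ ·) atTop fun k : ℕ => ‖(k : ℝ) / (k + n + 1)‖ := by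
    refine isBoundedUnder_of ⟨1, fun k => ?_⟩
    rw [Real.norm_of_nonneg (by positivity)]
    exact div_le_one_of_le₀ (by linarith [n.cast_nonneg (α := ℝ)]) (by positivity)
  have hlim : Tendsto v atTop (𝓝 0) := by
    have hb : Tendsto (fun k => Ring.multichoose a k) atTop (𝓝 0) := by
      rw [← Filter.tendsto_ofReal_iff]
      simpa [ofReal_multichoose] using tendsto_multichoose_zero (a := a) ha
    have hsq : Tendsto (fun k => -(n + 1) * Ring.multichoose a k ^ 2) atTop (𝓝 0) := by
      simpa using (hb.pow 2).const_mul (-(n + 1) : ℝ)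
    refine (hsq.zero_mul_isBoundedUnder_le hbdd).congr fun k => ?_
    simp only [hv]
    ring
  have hsum := tsum_succ_sub_eq_of_tendsto hlim ((hs₁.sub hs₂).congr htelescope)
  rw [← tsum_congr htelescope, show v 0 = 0 by simp [hv], sub_zero, hs₁.tsum_sub hs₂,
    tsum_mul_left, Summable.tsum_add ((summable_multichoose_sq_div ha n).mul_left _)
    ((summable_multichoose_sq_div ha 0).mul_left _), tsum_mul_left, tsum_mul_left] at hsum
  simpa [bergmanNormSq] using (sub_eq_zero.1 hsum)

theorem tsum_multichoose_succ_mul_multichoose_div (ha : a < 1) (n : ℕ) :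
    ∑' k : ℕ, Ring.multichoose a (k + 1) * Ring.multichoose a k / (k + n + 2) =
      ((a - 1) * bergmanNormSq a 0 + (n + 2 - a) * bergmanNormSq a (n + 1)) / (n + 1) := by
  have h := ((((summable_multichoose_sq_div ha 0).hasSum.mul_left (a - 1)).add
    ((summable_multichoose_sq_div ha (n + 1)).hasSum.mul_left (n + 2 - a))).div_const
      (n + 1 : ℝ)).tsum_eq
  rw [bergmanNormSq, bergmanNormSq, ← h]
  refine tsum_congr fun k => ?_
  rw [multichoose_succ]
  push_cast
  field_simp
  ring

theorem tsum_multichoose_add_two_mul_multichoose_div (ha : a < 1) :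
    ∑' k : ℕ, Ring.multichoose a (k + 2) * Ring.multichoose a k / (k + 3) =
      (a - 1) * a / 2 * bergmanNormSq a 0 - (a - 2) * (a - 1) * bergmanNormSq a 1 +
        (a - 3) * (a - 2) / 2 * bergmanNormSq a 2 := by
  have h := ((((summable_multichoose_sq_div ha 0).hasSum.mul_left ((a - 1) * a / 2)).sub
    ((summable_multichoose_sq_div ha 1).hasSum.mul_left ((a - 2) * (a - 1)))).add
    ((summable_multichoose_sq_div ha 2).hasSum.mul_left ((a - 3) * (a - 2) / 2))).tsum_eq
  rw [bergmanNormSq, bergmanNormSq, bergmanNormSq, ← h]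
  refine tsum_congr fun k => ?_
  rw [multichoose_succ, multichoose_succ]
  push_cast
  field_simp
  ring

end BergmanSums

namespace DirichletType

open PowerSeries

section Taylor

/-- The Taylor series of `f` at the origin, as a formal power series. -/
def taylor (f : ℂ → ℂ) : ℂ⟦X⟧ := PowerSeries.mk (coeff f)

theorem coeff_taylor (f : ℂ → ℂ) (k : ℕ) : PowerSeries.coeff k (taylor f) = coeff f k :=
  coeff_mk k _

theorem taylor_eq_mk_of_hasFPowerSeriesAt {f : ℂ → ℂ} {c : ℕ → ℂ}
    (h : HasFPowerSeriesAt f (.ofScalars ℂ c) 0) : taylor f = PowerSeries.mk c := by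
  have := congrArg FormalMultilinearSeries.coeff
    (h.analyticAt.hasFPowerSeriesAt.eq_formalMultilinearSeries h)
  ext k
  simpa [FormalMultilinearSeries.coeff_ofScalars, coeff_taylor, coeff] using congrFun this k

theorem taylor_add {f g : ℂ → ℂ} (hf : AnalyticAt ℂ f 0) (hg : AnalyticAt ℂ g 0) :
    taylor (f + g) = taylor f + taylor g := by
  ext k
  simp only [map_add, coeff_taylor, coeff, iteratedDeriv_add hf.contDiffAt hg.contDiffAt, add_div]

theorem taylor_smul (a : ℂ) (f : ℂ → ℂ) : taylor (a • f) = a • taylor f := by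
  ext k
  simp only [map_smul, coeff_taylor, coeff, iteratedDeriv_const_smul_field, smul_eq_mul,
    mul_div_assoc]

theorem taylor_mul {f g : ℂ → ℂ} (hf : AnalyticAt ℂ f 0) (hg : AnalyticAt ℂ g 0) :
    taylor (fun z => f z * g z) = taylor f * taylor g := by
  ext n
  rw [PowerSeries.coeff_mul, Finset.Nat.sum_antidiagonal_eq_sum_range_succ
    fun i j => PowerSeries.coeff i (taylor f) * PowerSeries.coeff j (taylor g)]
  simp only [coeff_taylor, coeff, iteratedDeriv_fun_mul hf.contDiffAt hg.contDiffAt,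
    Finset.sum_div]
  refine Finset.sum_congr rfl fun i hi => ?_
  have hn := Nat.cast_ne_zero (R := ℂ).2 n.factorial_ne_zero
  rw [Nat.cast_choose ℂ (Finset.mem_range_succ_iff.1 hi)]
  field_simp

theorem taylor_pow_eq_X_pow (n : ℕ) : taylor (fun z => z ^ n) = X ^ n := by
  ext k
  rw [coeff_taylor, coeff, iteratedDeriv_fun_pow_zero, coeff_X_pow]
  split_ifs with hk
  · rw [hk, div_self (Nat.cast_ne_zero.2 n.factorial_ne_zero)]
  · rw [Nat.cast_zero, zero_div]

theorem taylor_id_mul {f : ℂ → ℂ} (hf : AnalyticAt ℂ f 0) :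
    taylor (fun z => z * f z) = X * taylor f := by
  have hid : taylor (fun z => z) = X := by simpa only [pow_one] using taylor_pow_eq_X_pow 1
  rw [taylor_mul (f := fun z => z) analyticAt_id hf, hid]

theorem taylor_one_sub_cpow (a : ℂ) :
    taylor (fun z : ℂ => (1 - z) ^ (-a)) = PowerSeries.mk (Ring.multichoose a) := by
  have h := (Complex.one_div_one_sub_cpow_hasFPowerSeriesOnBall_zero a).hasFPowerSeriesAt
  simp_rw [← Ring.multichoose_eq, one_div, ← Complex.cpow_neg] at h
  exact taylor_eq_mk_of_hasFPowerSeriesAt h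

end Taylor

section Space

variable {α : ℝ}

theorem analyticAt_of_mem_space {f : ℂ → ℂ} (hf : f ∈ space α) : AnalyticAt ℂ f 0 :=
  hf.1.analyticAt (Metric.ball_mem_nhds 0 one_pos)

/-- The space `D_α` as a subspace of the space of all functions `ℂ → ℂ`. Functions that agree on
the unit disk are not identified. -/
def dirichletSpace (α : ℝ) : Submodule ℂ (ℂ → ℂ) where
  carrier := space α
  zero_mem' := ⟨differentiableOn_const 0, by
    have hcoeff (k : ℕ) : coeff 0 k = 0 := by simp [coeff]
    simp [hcoeff]⟩
  add_mem' {f g} hf hg := ⟨hf.1.add hg.1, by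
    refine Summable.of_nonneg_of_le (fun k => by positivity) (fun k => ?_)
      ((hf.2.add hg.2).mul_left 2)
    rw [← coeff_taylor, taylor_add (analyticAt_of_mem_space hf) (analyticAt_of_mem_space hg),
      map_add, coeff_taylor, coeff_taylor, ← mul_add, mul_left_comm]
    gcongr
    exact (pow_le_pow_left₀ (norm_nonneg _) (norm_add_le _ _) 2).trans add_sq_le⟩
  smul_mem' a f hf := ⟨hf.1.const_smul a, by
    refine (hf.2.mul_left (‖a‖ ^ 2)).congr fun k => ?_
    rw [← coeff_taylor (a • f), taylor_smul, map_smul, coeff_taylor, norm_smul]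
    ring⟩

theorem analyticAt_coe (f : dirichletSpace α) : AnalyticAt ℂ (f : ℂ → ℂ) 0 :=
  analyticAt_of_mem_space f.2

theorem norm_sqrt_mul_sq {w : ℝ} (hw : 0 ≤ w) (x : ℂ) : ‖(√w : ℂ) * x‖ ^ 2 = w * ‖x‖ ^ 2 := by
  rw [norm_mul, mul_pow, Complex.norm_real, Real.norm_eq_abs, sq_abs, Real.sq_sqrt hw]

/-- The map `D_α → ℓ²` sending `∑ a_k z^k` to the sequence `(k + 1) ^ (α / 2) * a_k`. It preserves
norms and inner products, which is how the Hilbert space structure of `ℓ²` is used on `D_α`. -/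
def toSeq (α : ℝ) : dirichletSpace α →ₗ[ℂ] lp (fun _ : ℕ => ℂ) 2 where
  toFun f := ⟨fun k => (√(((k : ℝ) + 1) ^ α) : ℂ) * coeff f k, by
    refine memℓp_gen (f.2.2.congr fun k => ?_)
    rw [ENNReal.toReal_ofNat, Real.rpow_two, norm_sqrt_mul_sq (by positivity)]⟩
  map_add' f g := by
    ext k
    rw [lp.coeFn_add]
    simp only [← coeff_taylor, Submodule.coe_add, taylor_add (analyticAt_coe f) (analyticAt_coe g),
      map_add, mul_add, Pi.add_apply]
  map_smul' a f := by
    ext k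
    simp only [← coeff_taylor, Submodule.coe_smul, taylor_smul, map_smul, smul_eq_mul,
      lp.coeFn_smul, Pi.smul_apply, RingHom.id_apply]
    ring

theorem toSeq_apply (f : dirichletSpace α) (k : ℕ) :
    toSeq α f k = (√(((k : ℝ) + 1) ^ α) : ℂ) * coeff f k := rfl

theorem norm_toSeq_sq (f : dirichletSpace α) :
    ‖toSeq α f‖ ^ 2 = ∑' k : ℕ, ((k : ℝ) + 1) ^ α * ‖coeff f k‖ ^ 2 := by
  have h := lp.norm_rpow_eq_tsum (p := 2) (by simp) (toSeq α f)
  rw [ENNReal.toReal_ofNat, Real.rpow_two] at h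
  simp only [h, Real.rpow_two, toSeq_apply]
  exact tsum_congr fun k => norm_sqrt_mul_sq (by positivity) _

theorem dnorm_eq_norm_toSeq (f : dirichletSpace α) : dnorm α f = ‖toSeq α f‖ := by
  rw [dnorm, ← norm_toSeq_sq, Real.sqrt_sq (norm_nonneg _)]

theorem dinner_eq_inner_toSeq (f g : dirichletSpace α) :
    dinner α f g = inner ℂ (toSeq α g) (toSeq α f) := by
  rw [lp.inner_eq_tsum, dinner]
  refine tsum_congr fun k => ?_
  have hsqrt : (√(((k : ℝ) + 1) ^ α) : ℂ) * √(((k : ℝ) + 1) ^ α) = (((k : ℝ) + 1) ^ α : ℝ) := by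
    rw [← Complex.ofReal_mul, Real.mul_self_sqrt (by positivity)]
  rw [toSeq_apply, toSeq_apply, RCLike.inner_apply, map_mul, Complex.conj_ofReal, ← hsqrt]
  ring

end Space

section Shift

variable {α : ℝ}

theorem rpow_add_two_le (α : ℝ) (k : ℕ) :
    ((k : ℝ) + 2) ^ α ≤ max 1 (2 ^ α) * ((k : ℝ) + 1) ^ α :=
  rpow_le_max_one_mul_rpow α (by positivity) (by linarith)
    (by linarith [k.cast_nonneg (α := ℝ)])

theorem id_mul_mem_dirichletSpace {f : ℂ → ℂ} (hf : f ∈ dirichletSpace α) :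
    (fun z => z * f z) ∈ dirichletSpace α := by
  refine ⟨differentiableOn_id.mul hf.1, (summable_nat_add_iff 1).1 ?_⟩
  refine .of_nonneg_of_le (fun k => by positivity) (fun k => ?_)
    (hf.2.mul_left (max 1 (2 ^ α)))
  rw [← coeff_taylor, taylor_id_mul (analyticAt_of_mem_space hf), PowerSeries.coeff_succ_X_mul,
    coeff_taylor, ← mul_assoc]
  push_cast
  rw [add_assoc, one_add_one_eq_two]
  gcongr
  exact rpow_add_two_le α k

/-- The forward shift: multiplication by the coordinate `z` on `D_α`. -/
def shift (α : ℝ) : Module.End ℂ (dirichletSpace α) where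
  toFun f := ⟨fun z => z * (f : ℂ → ℂ) z, id_mul_mem_dirichletSpace f.2⟩
  map_add' f g := by ext z; simp [mul_add]
  map_smul' a f := by ext z; simp [mul_left_comm]

theorem taylor_shift (f : dirichletSpace α) : taylor (shift α f) = X * taylor f :=
  taylor_id_mul (analyticAt_coe f)

theorem taylor_shift_pow (n : ℕ) (f : dirichletSpace α) :
    taylor ((shift α ^ n) f) = X ^ n * taylor f := by
  induction n with
  | zero => simp
  | succ n ih => rw [pow_succ', Module.End.mul_apply, taylor_shift, ih, pow_succ', mul_assoc]

theorem shift_pow_apply (n : ℕ) (f : dirichletSpace α) (z : ℂ) :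
    ((shift α ^ n) f : ℂ → ℂ) z = z ^ n * (f : ℂ → ℂ) z := by
  induction n with
  | zero => simp
  | succ n ih =>
    rw [pow_succ', Module.End.mul_apply, pow_succ', mul_assoc, ← ih]
    rfl

theorem norm_toSeq_shift_le (f : dirichletSpace α) :
    ‖toSeq α (shift α f)‖ ≤ √(max 1 (2 ^ α)) * ‖toSeq α f‖ := by
  rw [← sq_le_sq₀ (norm_nonneg _) (by positivity), mul_pow, Real.sq_sqrt (by positivity),
    norm_toSeq_sq, norm_toSeq_sq, (shift α f).2.2.tsum_eq_zero_add, ← tsum_mul_left]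
  have hzero : coeff (shift α f) 0 = 0 := by
    rw [← coeff_taylor, taylor_shift, PowerSeries.coeff_zero_X_mul]
  rw [hzero, norm_zero, zero_pow two_ne_zero, mul_zero, zero_add]
  refine ((summable_nat_add_iff 1).2 (shift α f).2.2).tsum_le_tsum (fun k => ?_) (f.2.2.mul_left _)
  rw [← coeff_taylor, taylor_shift, PowerSeries.coeff_succ_X_mul, coeff_taylor, ← mul_assoc,
    Nat.cast_succ, add_assoc, one_add_one_eq_two]
  gcongr
  exact rpow_add_two_le α k

theorem norm_toSeq_shift_pow_le (hα : α ≤ 0) (n : ℕ) (f : dirichletSpace α) :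
    ‖toSeq α ((shift α ^ n) f)‖ ≤ ‖toSeq α f‖ := by
  have hmax : max 1 ((2 : ℝ) ^ α) = 1 :=
    max_eq_left (Real.rpow_le_one_of_one_le_of_nonpos one_le_two hα)
  induction n with
  | zero => simp
  | succ n ih =>
    rw [pow_succ', Module.End.mul_apply]
    refine (norm_toSeq_shift_le _).trans ?_
    rwa [hmax, Real.sqrt_one, one_mul]

end Shift

section PolynomialMultiples

variable {α : ℝ}

theorem aeval_shift_apply (p : Polynomial ℂ) (f : dirichletSpace α) (z : ℂ) :
    (Polynomial.aeval (shift α) p f : ℂ → ℂ) z = p.eval z * (f : ℂ → ℂ) z := by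
  induction p using Polynomial.induction_on' with
  | add p q hp hq => simp [hp, hq, add_mul]
  | monomial n c =>
    rw [Polynomial.aeval_monomial, ← Algebra.smul_def, Polynomial.eval_monomial, mul_assoc,
      ← shift_pow_apply]
    rfl

theorem taylor_aeval_shift (p : Polynomial ℂ) (f : dirichletSpace α) :
    taylor (Polynomial.aeval (shift α) p f) = p * taylor f := by
  induction p using Polynomial.induction_on' with
  | add p q hp hq =>
    rw [map_add, LinearMap.add_apply, Submodule.coe_add, Polynomial.coe_add, add_mul, ← hp, ← hq,
      taylor_add (analyticAt_coe _) (analyticAt_coe _)]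
  | monomial n c =>
    rw [Polynomial.aeval_monomial, ← Algebra.smul_def, LinearMap.smul_apply, Submodule.coe_smul,
      taylor_smul, taylor_shift_pow, Polynomial.coe_monomial, X_pow_eq, ← smul_mul_assoc,
      ← map_smul, smul_eq_mul, mul_one]

theorem one_mem_dirichletSpace (α : ℝ) : (fun _ => 1 : ℂ → ℂ) ∈ dirichletSpace α := by
  refine ⟨differentiableOn_const 1, summable_of_ne_finset_zero (s := {0}) fun k hk => ?_⟩
  have h := taylor_pow_eq_X_pow 0
  simp only [pow_zero] at h
  rw [← coeff_taylor, h, PowerSeries.coeff_one, if_neg (by simpa using hk)]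
  simp

/-- The constant function `1` as an element of `D_α`. -/
def one (α : ℝ) : dirichletSpace α := ⟨fun _ => 1, one_mem_dirichletSpace α⟩

theorem taylor_one : taylor (one α) = 1 := by
  have h := taylor_pow_eq_X_pow 0
  simp only [pow_zero] at h
  exact h

end PolynomialMultiples

section Cyclicity

variable {α : ℝ} {f g : dirichletSpace α}

/-- The closed subspace `[f]` of `D_α` generated by the functions `z ^ k * f`, as a submodule. The
closure is taken in `ℓ²`, where the norm of `D_α` lives. -/
def closedMultiples (f : dirichletSpace α) : Submodule ℂ (dirichletSpace α) :=
  ((Submodule.span ℂ (Set.range fun j : ℕ => (shift α ^ j) f)).map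
    (toSeq α)).topologicalClosure.comap (toSeq α)

theorem mem_closedMultiples_iff : g ∈ closedMultiples f ↔ ∀ ε : ℝ, 0 < ε →
    ∃ h ∈ Submodule.span ℂ (Set.range fun j : ℕ => (shift α ^ j) f), ‖toSeq α (g - h)‖ < ε := by
  rw [closedMultiples, Submodule.mem_comap, ← SetLike.mem_coe,
    Submodule.topologicalClosure_coe, Metric.mem_closure_iff]
  simp only [Submodule.map_coe, Set.exists_mem_image, SetLike.mem_coe, dist_eq_norm, map_sub,
    gt_iff_lt]

theorem shift_pow_mem_closedMultiples (f : dirichletSpace α) (j : ℕ) :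
    (shift α ^ j) f ∈ closedMultiples f :=
  Submodule.le_topologicalClosure _
    (Submodule.mem_map_of_mem (Submodule.subset_span (Set.mem_range_self j)))

theorem mem_closedMultiples_of_tendsto {u : ℕ → dirichletSpace α}
    (hu : ∀ n, u n ∈ closedMultiples f)
    (h : Tendsto (fun n => toSeq α (u n)) atTop (𝓝 (toSeq α g))) : g ∈ closedMultiples f :=
  (Submodule.isClosed_topologicalClosure _).mem_of_tendsto h (.of_forall hu)

theorem shift_mem_closedMultiples (hg : g ∈ closedMultiples f) :
    shift α g ∈ closedMultiples f := by
  rw [mem_closedMultiples_iff] at hg ⊢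
  intro ε hε
  have hC : 0 < √(max 1 ((2 : ℝ) ^ α)) := by positivity
  obtain ⟨h, hh, hgh⟩ := hg (ε / √(max 1 (2 ^ α))) (by positivity)
  refine ⟨shift α h, ?_, ?_⟩
  · have hmap := Submodule.mem_map_of_mem (f := shift α) hh
    rw [Submodule.map_span, ← Set.range_comp] at hmap
    refine Submodule.span_mono ?_ hmap
    rintro _ ⟨j, rfl⟩
    exact ⟨j + 1, congrArg (· f) (pow_succ' (shift α) j)⟩
  · rw [← map_sub]
    exact (norm_toSeq_shift_le _).trans_lt ((lt_div_iff₀' hC).1 hgh)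

theorem closedMultiples_le_of_mem (hg : g ∈ closedMultiples f) :
    closedMultiples g ≤ closedMultiples f := by
  have hspan : Submodule.span ℂ (Set.range fun j : ℕ => (shift α ^ j) g) ≤ closedMultiples f := by
    rw [Submodule.span_le]
    rintro _ ⟨j, rfl⟩
    induction j with
    | zero => exact hg
    | succ j ih =>
      have hmem := shift_mem_closedMultiples ih
      simpa only [pow_succ', Module.End.mul_apply, SetLike.mem_coe] using hmem
  exact Submodule.comap_mono (Submodule.topologicalClosure_minimal _
    (Submodule.map_le_iff_le_comap.2 hspan) (Submodule.isClosed_topologicalClosure _))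

theorem hasSum_smul_toSeq_shift_pow (hα : α ≤ 0) {W : ℂ⟦X⟧}
    (hW : Summable fun j => ‖PowerSeries.coeff j W‖) (h : taylor g = W * taylor f) :
    HasSum (fun j => PowerSeries.coeff j W • toSeq α ((shift α ^ j) f)) (toSeq α g) := by
  have hsum : Summable fun j => PowerSeries.coeff j W • toSeq α ((shift α ^ j) f) := by
    refine .of_norm_bounded (hW.mul_right ‖toSeq α f‖) fun j => ?_
    rw [norm_smul]
    gcongr
    exact norm_toSeq_shift_pow_le hα j f
  suffices ∑' j, PowerSeries.coeff j W • toSeq α ((shift α ^ j) f) = toSeq α g from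
    this ▸ hsum.hasSum
  ext k
  refine (hsum.hasSum.mapL (lp.evalCLM ℂ (fun _ : ℕ => ℂ) 2 k)).unique ?_
  have hterm (j : ℕ) : lp.evalCLM ℂ (fun _ : ℕ => ℂ) 2 k
      (PowerSeries.coeff j W • toSeq α ((shift α ^ j) f)) = √(((k : ℝ) + 1) ^ α) *
        (PowerSeries.coeff j W * if j ≤ k then PowerSeries.coeff (k - j) (taylor f) else 0) := by
    rw [← PowerSeries.coeff_X_pow_mul', ← taylor_shift_pow, map_smul, coeff_taylor, smul_eq_mul,
      mul_left_comm]
    rfl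
  have hzero : ∀ j ∉ Finset.range (k + 1), PowerSeries.coeff j W *
      (if j ≤ k then PowerSeries.coeff (k - j) (taylor f) else 0) = 0 := fun j hj => by
    rw [if_neg (by simpa using hj), mul_zero]
  simp only [hterm, toSeq_apply]
  rw [← coeff_taylor, h, PowerSeries.coeff_mul, Finset.Nat.sum_antidiagonal_eq_sum_range_succ
    fun i j => PowerSeries.coeff i W * PowerSeries.coeff j (taylor f)]
  have hsum_eq : ∑ j ∈ Finset.range (k + 1), PowerSeries.coeff j W *
      (if j ≤ k then PowerSeries.coeff (k - j) (taylor f) else 0) =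
      ∑ j ∈ Finset.range (k + 1), PowerSeries.coeff j W * PowerSeries.coeff (k - j) (taylor f) :=
    Finset.sum_congr rfl fun j hj => by rw [if_pos (Finset.mem_range_succ_iff.1 hj)]
  exact (hsum_eq ▸ hasSum_sum_of_ne_finset_zero hzero).mul_left _

theorem mem_closedMultiples_of_taylor_eq_mul (hα : α ≤ 0) {W : ℂ⟦X⟧}
    (hW : Summable fun j => ‖PowerSeries.coeff j W‖) (h : taylor g = W * taylor f) :
    g ∈ closedMultiples f := by
  refine mem_closedMultiples_of_tendsto
    (u := fun n => ∑ j ∈ Finset.range n, PowerSeries.coeff j W • (shift α ^ j) f) (fun n => ?_) ?_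
  · exact Submodule.sum_mem _ fun j _ =>
      Submodule.smul_mem _ _ (shift_pow_mem_closedMultiples f j)
  · simpa only [map_sum, map_smul] using (hasSum_smul_toSeq_shift_pow hα hW h).tendsto_sum_nat

theorem toSeq_shift_pow_one (k : ℕ) :
    toSeq α ((shift α ^ k) (one α)) = lp.single 2 k (√(((k : ℝ) + 1) ^ α) : ℂ) := by
  ext j
  rw [toSeq_apply, ← coeff_taylor, taylor_shift_pow, taylor_one, mul_one, coeff_X_pow]
  rcases eq_or_ne j k with rfl | hjk
  · simp
  · simp [hjk]

theorem closedMultiples_one : closedMultiples (one α) = ⊤ := by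
  refine eq_top_iff.2 fun g _ => mem_closedMultiples_of_tendsto
    (u := fun n => ∑ j ∈ Finset.range n, coeff g j • (shift α ^ j) (one α)) (fun n => ?_) ?_
  · exact Submodule.sum_mem _ fun j _ =>
      Submodule.smul_mem _ _ (shift_pow_mem_closedMultiples _ j)
  · have hsum := (lp.hasSum_single (by simp) (toSeq α g)).tendsto_sum_nat
    refine hsum.congr fun n => ?_
    simp only [map_sum, map_smul, toSeq_shift_pow_one, ← lp.single_smul, toSeq_apply,
      smul_eq_mul, mul_comm]

theorem isCyclic_of_one_mem_closedMultiples (h : one α ∈ closedMultiples f) : IsCyclic α f := by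
  refine ⟨f.2, Set.Subset.antisymm (fun _ hg => hg.1) fun g hg => ⟨hg, fun ε hε => ?_⟩⟩
  have hg' : (⟨g, hg⟩ : dirichletSpace α) ∈ closedMultiples f :=
    closedMultiples_le_of_mem h (closedMultiples_one (α := α) ▸ Submodule.mem_top)
  obtain ⟨u, hu, hlt⟩ := mem_closedMultiples_iff.1 hg' ε hε
  refine ⟨u, ?_, by rwa [← dnorm_eq_norm_toSeq] at hlt⟩
  have hmap := Submodule.mem_map_of_mem (f := (dirichletSpace α).subtype) hu
  rw [Submodule.map_span, ← Set.range_comp] at hmap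
  have hfun : (fun (k : ℕ) (z : ℂ) => z ^ k * (f : ℂ → ℂ) z) =
      (dirichletSpace α).subtype ∘ fun j => (shift α ^ j) f :=
    funext fun j => funext fun z => (shift_pow_apply j f z).symm
  exact hfun ▸ hmap

theorem tendsto_toSeq_shift_pow_one (hα : α < 0) :
    Tendsto (fun n => toSeq α ((shift α ^ n) (one α))) atTop (𝓝 0) := by
  have hrpow : Tendsto (fun n : ℕ => ((n : ℝ) + 1) ^ α) atTop (𝓝 0) := by
    simpa only [neg_neg, Function.comp_def] using (tendsto_rpow_neg_atTop (neg_pos.2 hα)).comp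
      (tendsto_atTop_add_const_right _ 1 tendsto_natCast_atTop_atTop)
  refine tendsto_zero_iff_norm_tendsto_zero.2 ?_
  simpa [toSeq_shift_pow_one, lp.norm_single, abs_of_nonneg] using hrpow.sqrt

theorem one_mem_closedMultiples_one_sub_C_mul_X (hα : α < 0) {ζ : ℂ} (hζ : ‖ζ‖ ≤ 1) :
    one α ∈ closedMultiples
      (Polynomial.aeval (shift α) (1 - Polynomial.C ζ * Polynomial.X) (one α)) := by
  -- `(1 - ζz) ∑_{j < n} (ζz)^j = 1 - (ζz)^n → 1`
  have hf : Polynomial.aeval (shift α) (1 - Polynomial.C ζ * Polynomial.X) (one α) =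
      one α - ζ • shift α (one α) := by
    simp [← Algebra.smul_def]
  rw [hf]
  refine mem_closedMultiples_of_tendsto
    (u := fun n => one α - ζ ^ n • (shift α ^ n) (one α)) (fun n => ?_) ?_
  · induction n with
    | zero => simp
    | succ n ih =>
      convert! Submodule.add_mem _ ih
        (Submodule.smul_mem _ (ζ ^ n) (shift_pow_mem_closedMultiples _ n)) using 1
      simp only [map_sub, map_smul, smul_sub, smul_smul, pow_succ, Module.End.mul_apply]
      abel
  · have hbdd : IsBoundedUnder (· ≤ ·) atTop fun n => ‖ζ ^ n‖ :=
      isBoundedUnder_of ⟨1, fun n => by simpa using pow_le_one₀ (norm_nonneg ζ) hζ⟩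
    have hlim := hbdd.smul_tendsto_zero (tendsto_toSeq_shift_pow_one hα)
    simpa only [map_sub, map_smul, sub_zero] using hlim.const_sub (toSeq α (one α))

theorem isCyclic_of_mul_taylor_eq {W : ℂ⟦X⟧} {ζ : ℂ} (hα : α < 0) (hζ : ‖ζ‖ ≤ 1)
    (hW : Summable fun j => ‖PowerSeries.coeff j W‖)
    (h : W * taylor f = ((1 - Polynomial.C ζ * Polynomial.X : Polynomial ℂ) : ℂ⟦X⟧)) :
    IsCyclic α f := by
  refine isCyclic_of_one_mem_closedMultiples (closedMultiples_le_of_mem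
    (mem_closedMultiples_of_taylor_eq_mul hα.le hW ?_)
    (one_mem_closedMultiples_one_sub_C_mul_X hα hζ))
  rw [taylor_aeval_shift, taylor_one, mul_one, h]

end Cyclicity

section OneSubCpow

variable {α : ℝ} {a : ℂ}

theorem one_sub_mem_slitPlane {z : ℂ} (hz : z ∈ Metric.ball (0 : ℂ) 1) :
    1 - z ∈ Complex.slitPlane := by
  have hre := (Complex.re_le_norm z).trans_lt (mem_ball_zero_iff.1 hz)
  exact Or.inl (by simpa using hre)

theorem differentiableOn_one_sub_cpow (a : ℂ) :
    DifferentiableOn ℂ (fun z : ℂ => (1 - z) ^ a) (Metric.ball 0 1) :=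
  fun _ hz => ((differentiableAt_id.const_sub 1).cpow_const
    (one_sub_mem_slitPlane hz)).differentiableWithinAt

theorem one_sub_cpow_mem_dirichletSpace (h : 2 * a.re < 1 - α) :
    (fun z : ℂ => (1 - z) ^ (-a)) ∈ dirichletSpace α := by
  refine ⟨differentiableOn_one_sub_cpow (-a),
    (summable_rpow_mul_norm_multichoose_sq h).congr fun k => ?_⟩
  rw [← coeff_taylor, taylor_one_sub_cpow, PowerSeries.coeff_mk]

theorem mk_multichoose_mul_mk_multichoose_neg (a : ℂ) :
    PowerSeries.mk (Ring.multichoose (-a)) * PowerSeries.mk (Ring.multichoose a) = 1 := by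
  have hball : Metric.ball (0 : ℂ) 1 ∈ 𝓝 0 := Metric.ball_mem_nhds 0 one_pos
  have han (b : ℂ) : AnalyticAt ℂ (fun z : ℂ => (1 - z) ^ b) 0 :=
    (differentiableOn_one_sub_cpow b).analyticAt hball
  rw [← taylor_one_sub_cpow, ← taylor_one_sub_cpow, ← taylor_mul (han _) (han _),
    ← taylor_one (α := 0)]
  ext k
  rw [coeff_taylor, coeff_taylor, coeff, coeff]
  congr 1
  refine Filter.EventuallyEq.iteratedDeriv_eq k ?_
  filter_upwards [hball] with z hz
  rw [Complex.cpow_neg _ (-a), inv_mul_cancel₀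
    (Complex.cpow_ne_zero_iff.2 (.inl (Complex.slitPlane_ne_zero (one_sub_mem_slitPlane hz))))]
  rfl

/-- The function `(1 - z) ^ (-a)`, with the principal branch of the power, as an element of
`D_α`. -/
def oneSubCpow (h : 2 * a.re < 1 - α) : dirichletSpace α :=
  ⟨fun z => (1 - z) ^ (-a), one_sub_cpow_mem_dirichletSpace h⟩

theorem taylor_oneSubCpow (h : 2 * a.re < 1 - α) :
    taylor (oneSubCpow h) = PowerSeries.mk (Ring.multichoose a) :=
  taylor_one_sub_cpow a

theorem isCyclic_aeval_shift_oneSubCpow (hα : α < 0) (ha : 0 < a.re) (h : 2 * a.re < 1 - α)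
    {ζ : ℂ} (hζ : ‖ζ‖ ≤ 1) :
    IsCyclic α (Polynomial.aeval (shift α) (1 - Polynomial.C ζ * Polynomial.X)
      (oneSubCpow h)) := by
  refine isCyclic_of_mul_taylor_eq (W := PowerSeries.mk (Ring.multichoose (-a))) hα hζ ?_ ?_
  · simpa only [PowerSeries.coeff_mk] using
      summable_norm_multichoose (a := -a) (by rwa [Complex.neg_re, neg_lt_zero])
  · rw [taylor_aeval_shift, taylor_oneSubCpow, mul_left_comm,
      mk_multichoose_mul_mk_multichoose_neg, mul_one]

end OneSubCpow

section InnerProducts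

theorem dinner_shift_pow_shift_pow {α : ℝ} (u v : dirichletSpace α) (n m : ℕ) :
    dinner α ((shift α ^ n) u) ((shift α ^ (n + m)) v) =
      ∑' k : ℕ, ((((k : ℝ) + n + m + 1) ^ α : ℝ) : ℂ) * coeff u (k + m) * conj (coeff v k) := by
  rw [dinner]
  refine ((add_left_injective (n + m)).tsum_eq fun k hk => ?_).symm.trans
    (tsum_congr fun k => ?_)
  · refine ⟨k - (n + m), Nat.sub_add_cancel (not_lt.1 fun hlt => hk ?_)⟩
    simp only [← coeff_taylor _ k, taylor_shift_pow, PowerSeries.coeff_X_pow_mul', hlt.not_ge,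
      if_false, map_zero, mul_zero]
  · rw [← coeff_taylor, ← coeff_taylor, taylor_shift_pow, taylor_shift_pow,
      PowerSeries.coeff_X_pow_mul, add_left_comm, add_comm n (k + m),
      PowerSeries.coeff_X_pow_mul, coeff_taylor, coeff_taylor]
    push_cast
    ring_nf

variable {a : ℝ}

/-- The function `(1 - z) ^ (-a)`, for real `a < 1`, as an element of the Bergman space `D₋₁`. -/
def bergmanOneSubCpow (ha : a < 1) : dirichletSpace (-1) :=
  oneSubCpow (a := a) (by rw [Complex.ofReal_re]; linarith)

theorem inner_toSeq_shift_pow_bergmanOneSubCpow (ha : a < 1) (n m : ℕ) :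
    inner ℂ (toSeq (-1) ((shift (-1) ^ (n + m)) (bergmanOneSubCpow ha)))
        (toSeq (-1) ((shift (-1) ^ n) (bergmanOneSubCpow ha))) =
      (∑' k : ℕ, Ring.multichoose a (k + m) * Ring.multichoose a k / (k + n + m + 1) : ℝ) := by
  rw [← dinner_eq_inner_toSeq, dinner_shift_pow_shift_pow, Complex.ofReal_tsum]
  refine tsum_congr fun k => ?_
  rw [← coeff_taylor, ← coeff_taylor, bergmanOneSubCpow, taylor_oneSubCpow, PowerSeries.coeff_mk,
    PowerSeries.coeff_mk, ← ofReal_multichoose, ← ofReal_multichoose, Complex.conj_ofReal,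
    Real.rpow_neg_one, div_eq_mul_inv, mul_assoc, mul_comm]
  push_cast
  rfl

theorem inner_toSeq_shift_pow_self_bergmanOneSubCpow (ha : a < 1) (n : ℕ) :
    inner ℂ (toSeq (-1) ((shift (-1) ^ n) (bergmanOneSubCpow ha)))
      (toSeq (-1) ((shift (-1) ^ n) (bergmanOneSubCpow ha))) = bergmanNormSq a n := by
  simpa [bergmanNormSq, sq] using inner_toSeq_shift_pow_bergmanOneSubCpow ha n 0

theorem inner_toSeq_shift_pow_succ_bergmanOneSubCpow (ha : a < 1) (n : ℕ) :
    inner ℂ (toSeq (-1) ((shift (-1) ^ (n + 1)) (bergmanOneSubCpow ha)))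
        (toSeq (-1) ((shift (-1) ^ n) (bergmanOneSubCpow ha))) =
      (((a - 1) * bergmanNormSq a 0 + (n + 2 - a) * bergmanNormSq a (n + 1)) / (n + 1) : ℝ) := by
  rw [inner_toSeq_shift_pow_bergmanOneSubCpow, ← tsum_multichoose_succ_mul_multichoose_div ha]
  norm_num [add_assoc]

theorem inner_toSeq_shift_sq_bergmanOneSubCpow (ha : a < 1) :
    inner ℂ (toSeq (-1) ((shift (-1) ^ 2) (bergmanOneSubCpow ha)))
        (toSeq (-1) (bergmanOneSubCpow ha)) =
      ((a - 1) * a / 2 * bergmanNormSq a 0 - (a - 2) * (a - 1) * bergmanNormSq a 1 +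
        (a - 3) * (a - 2) / 2 * bergmanNormSq a 2 : ℝ) := by
  rw [← tsum_multichoose_add_two_mul_multichoose_div ha]
  have h := inner_toSeq_shift_pow_bergmanOneSubCpow ha 0 2
  norm_num [add_assoc] at h ⊢
  exact h

theorem bergmanNormSq_one (ha : a < 1) :
    bergmanNormSq a 1 = (2 - 2 * a + a ^ 2) * bergmanNormSq a 0 / (2 - a) ^ 2 := by
  rw [eq_div_iff (pow_ne_zero 2 (by linarith))]
  linear_combination (norm := (norm_num; ring)) bergmanNormSq_succ ha 0

theorem bergmanNormSq_two (ha : a < 1) :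
    bergmanNormSq a 2 =
      (4 * bergmanNormSq a 1 + (1 - a) ^ 2 * bergmanNormSq a 0) / (3 - a) ^ 2 := by
  rw [eq_div_iff (pow_ne_zero 2 (by linarith))]
  linear_combination (norm := (norm_num; ring)) bergmanNormSq_succ ha 1

/-- The function `(1 + z) * (1 - z) ^ (-a)`, for real `a < 1`, as an element of the Bergman space
`D₋₁`. -/
def bergmanOneAddMulOneSubCpow (ha : a < 1) : dirichletSpace (-1) :=
  bergmanOneSubCpow ha + shift (-1) (bergmanOneSubCpow ha)

theorem Gamma_three_sub (h : 2 - a ≠ 0) :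
    Real.Gamma (3 - a) = (2 - a) * Real.Gamma (2 - a) := by
  rw [← Real.Gamma_add_one h]
  ring_nf

theorem Gamma_four_sub (h : 3 - a ≠ 0) :
    Real.Gamma (4 - a) = (3 - a) * Real.Gamma (3 - a) := by
  rw [← Real.Gamma_add_one h]
  ring_nf

theorem shift_bergmanOneAddMulOneSubCpow (ha : a < 1) :
    shift (-1) (bergmanOneAddMulOneSubCpow ha) =
      (shift (-1) ^ 2) (bergmanOneSubCpow ha) + (shift (-1) ^ 1) (bergmanOneSubCpow ha) := by
  rw [bergmanOneAddMulOneSubCpow, map_add, add_comm, sq, pow_one, Module.End.mul_apply]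

theorem dnorm_shift_bergmanOneAddMulOneSubCpow_sq (ha : a < 1) :
    dnorm (-1) (shift (-1) (bergmanOneAddMulOneSubCpow ha)) ^ 2 =
      (30 - 26 * a + 14 * a ^ 2 - 2 * a ^ 3) *
        (Real.Gamma (2 - 2 * a) / Real.Gamma (4 - a) ^ 2) := by
  have hexpand : dnorm (-1) (shift (-1) (bergmanOneAddMulOneSubCpow ha)) ^ 2 =
      (a - 1) * bergmanNormSq a 0 + bergmanNormSq a 1 + (4 - a) * bergmanNormSq a 2 := by
    rw [dnorm_eq_norm_toSeq, shift_bergmanOneAddMulOneSubCpow, map_add, norm_add_sq (𝕜 := ℂ),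
      ← inner_self_eq_norm_sq (𝕜 := ℂ), ← inner_self_eq_norm_sq (𝕜 := ℂ),
      inner_toSeq_shift_pow_succ_bergmanOneSubCpow ha 1,
      inner_toSeq_shift_pow_self_bergmanOneSubCpow,
      inner_toSeq_shift_pow_self_bergmanOneSubCpow]
    simp only [RCLike.re_to_complex, Complex.ofReal_re]
    push_cast
    ring
  have hΓ : Real.Gamma (2 - a) ≠ 0 := (Real.Gamma_pos_of_pos (by linarith)).ne'
  have h₂ : 2 - a ≠ 0 := by linarith
  have h₃ : 3 - a ≠ 0 := by linarith
  rw [hexpand, bergmanNormSq_two ha, bergmanNormSq_one ha, bergmanNormSq_zero ha,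
    Gamma_four_sub h₃, Gamma_three_sub h₂]
  field_simp
  ring

theorem dinner_bergmanOneAddMulOneSubCpow_shift (ha : a < 1) :
    dinner (-1) (bergmanOneAddMulOneSubCpow ha) (shift (-1) (bergmanOneAddMulOneSubCpow ha)) =
      (2 * (1 + a) * (Real.Gamma (2 - 2 * a) / Real.Gamma (3 - a) ^ 2) : ℝ) := by
  have hexpand : dinner (-1) (bergmanOneAddMulOneSubCpow ha)
        (shift (-1) (bergmanOneAddMulOneSubCpow ha)) =
      ((a - 1) * (a + 3) / 2 * bergmanNormSq a 0 + (1 + 2 * a - a ^ 2) * bergmanNormSq a 1 +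
        (3 - a) ^ 2 / 2 * bergmanNormSq a 2 : ℝ) := by
    have h₀₁ := inner_toSeq_shift_pow_succ_bergmanOneSubCpow ha 0
    have h₁₁ := inner_toSeq_shift_pow_self_bergmanOneSubCpow ha 1
    have h₁₂ := inner_toSeq_shift_pow_succ_bergmanOneSubCpow ha 1
    rw [pow_one] at h₁₁ h₁₂
    rw [zero_add, pow_one, pow_zero, Module.End.one_apply] at h₀₁
    rw [dinner_eq_inner_toSeq, shift_bergmanOneAddMulOneSubCpow, bergmanOneAddMulOneSubCpow,
      pow_one, map_add, map_add, inner_add_left, inner_add_right, inner_add_right,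
      inner_toSeq_shift_sq_bergmanOneSubCpow ha, h₀₁, h₁₂, h₁₁]
    push_cast
    ring
  have hΓ : Real.Gamma (2 - a) ≠ 0 := (Real.Gamma_pos_of_pos (by linarith)).ne'
  have h₂ : 2 - a ≠ 0 := by linarith
  have h₃ : 3 - a ≠ 0 := by linarith
  rw [hexpand, bergmanNormSq_two ha, bergmanNormSq_one ha, bergmanNormSq_zero ha,
    Gamma_three_sub h₂]
  congr 1
  field_simp
  ring

end InnerProducts

section OptimalApproximants

theorem forall_norm_sub_le_iff_starProjection_eq {𝕜 E : Type*} [RCLike 𝕜] [NormedAddCommGroup E]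
    [InnerProductSpace 𝕜 E] {K : Submodule 𝕜 E} [K.HasOrthogonalProjection] {u v : E}
    (hv : v ∈ K) : (∀ w ∈ K, ‖u - v‖ ≤ ‖u - w‖) ↔ K.starProjection u = v := by
  have hbdd : BddBelow (Set.range fun w : K => ‖u - w‖) :=
    ⟨0, Set.forall_mem_range.2 fun _ => norm_nonneg _⟩
  constructor
  · intro h
    refine Submodule.eq_starProjection_of_mem_of_inner_eq_zero hv
      ((K.norm_eq_iInf_iff_inner_eq_zero hv).1 ?_)
    exact le_antisymm (le_ciInf fun w => h w w.2) (ciInf_le hbdd ⟨v, hv⟩)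
  · rintro rfl w hw
    rw [Submodule.starProjection_minimal]
    exact ciInf_le hbdd ⟨w, hw⟩

variable {α : ℝ} {f : dirichletSpace α} {n : ℕ} {p : Polynomial ℂ}

/-- The map sending a polynomial `p` to the multiple `p f`, read in `ℓ²` through `toSeq`. -/
def polynomialMultiple (f : dirichletSpace α) : Polynomial ℂ →ₗ[ℂ] lp (fun _ : ℕ => ℂ) 2 :=
  toSeq α ∘ₗ LinearMap.applyₗ f ∘ₗ (Polynomial.aeval (shift α)).toLinearMap

theorem polynomialMultiple_apply (f : dirichletSpace α) (p : Polynomial ℂ) :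
    polynomialMultiple f p = toSeq α (Polynomial.aeval (shift α) p f) := rfl

theorem taylor_eq_zero_of_toSeq_eq_zero (h : toSeq α f = 0) : taylor f = 0 := by
  ext k
  have hk : toSeq α f k = 0 := by rw [h]; rfl
  have hw : (√(((k : ℝ) + 1) ^ α) : ℂ) ≠ 0 :=
    Complex.ofReal_ne_zero.2 (Real.sqrt_pos.2 (by positivity)).ne'
  rw [coeff_taylor, map_zero]
  exact (mul_eq_zero.1 hk).resolve_left hw

theorem injective_polynomialMultiple (hf : taylor f ≠ 0) :
    Function.Injective (polynomialMultiple f) := by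
  refine (injective_iff_map_eq_zero _).2 fun p hp => ?_
  rw [polynomialMultiple_apply] at hp
  have h := taylor_eq_zero_of_toSeq_eq_zero hp
  rw [taylor_aeval_shift, mul_eq_zero_iff_right hf] at h
  exact Polynomial.coe_eq_zero_iff.1 h

theorem dnorm_eval_mul_sub_one (f : dirichletSpace α) (p : Polynomial ℂ) :
    dnorm α (fun z => p.eval z * (f : ℂ → ℂ) z - 1) =
      ‖toSeq α (one α) - polynomialMultiple f p‖ := by
  have hfun : (fun z => p.eval z * (f : ℂ → ℂ) z - 1) =
      (Polynomial.aeval (shift α) p f - one α : dirichletSpace α) :=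
    funext fun z => congrArg (· - 1) (aeval_shift_apply p f z).symm
  rw [hfun, dnorm_eq_norm_toSeq, map_sub, norm_sub_rev, polynomialMultiple_apply]

/-- The finite-dimensional space of multiples `p f` with `p` of degree at most `n`, read in `ℓ²`. -/
def polynomialMultiples (f : dirichletSpace α) (n : ℕ) : Submodule ℂ (lp (fun _ : ℕ => ℂ) 2) :=
  (Polynomial.degreeLT ℂ (n + 1)).map (polynomialMultiple f)

instance : FiniteDimensional ℂ (polynomialMultiples f n) :=
  Module.Finite.map _ _

theorem mem_polynomialMultiples_iff {x : lp (fun _ : ℕ => ℂ) 2} :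
    x ∈ polynomialMultiples f n ↔
      ∃ p : Polynomial ℂ, p.natDegree ≤ n ∧ polynomialMultiple f p = x := by
  simp only [polynomialMultiples, Submodule.mem_map, Polynomial.degreeLT_succ_eq_degreeLE,
    Polynomial.mem_degreeLE, Polynomial.natDegree_le_iff_degree_le]

theorem isOptimalApproximant_iff : IsOptimalApproximant α f n p ↔ p.natDegree ≤ n ∧
    (polynomialMultiples f n).starProjection (toSeq α (one α)) = polynomialMultiple f p := by
  refine ⟨fun ⟨_, hp, hmin⟩ => ⟨hp, ?_⟩, fun ⟨hp, hproj⟩ => ⟨f.2, hp, ?_⟩⟩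
  · refine (forall_norm_sub_le_iff_starProjection_eq
      (mem_polynomialMultiples_iff.2 ⟨p, hp, rfl⟩)).1 fun w hw => ?_
    obtain ⟨q, hq, rfl⟩ := mem_polynomialMultiples_iff.1 hw
    simpa only [dnorm_eval_mul_sub_one] using hmin q hq
  · intro q hq
    rw [dnorm_eval_mul_sub_one, dnorm_eval_mul_sub_one]
    exact (forall_norm_sub_le_iff_starProjection_eq
      (mem_polynomialMultiples_iff.2 ⟨p, hp, rfl⟩)).2 hproj _
      (mem_polynomialMultiples_iff.2 ⟨q, hq, rfl⟩)

theorem existsUnique_isOptimalApproximant (hf : taylor f ≠ 0) (n : ℕ) :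
    ∃! p, IsOptimalApproximant α f n p := by
  obtain ⟨p, hp, hproj⟩ := mem_polynomialMultiples_iff.1
    ((polynomialMultiples f n).starProjection_apply_mem (toSeq α (one α)))
  refine ⟨p, isOptimalApproximant_iff.2 ⟨hp, hproj.symm⟩, fun q hq => ?_⟩
  exact injective_polynomialMultiple hf ((isOptimalApproximant_iff.1 hq).2.symm.trans hproj.symm)

theorem IsOptimalApproximant.inner_eq_zero (hp : IsOptimalApproximant α f n p) {q : Polynomial ℂ}
    (hq : q.natDegree ≤ n) :
    inner ℂ (polynomialMultiple f q) (toSeq α (one α) - polynomialMultiple f p) = 0 := by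
  rw [← (isOptimalApproximant_iff.1 hp).2]
  exact inner_eq_zero_symm.1 (Submodule.starProjection_inner_eq_zero _ _
    (mem_polynomialMultiples_iff.2 ⟨q, hq, rfl⟩))

theorem inner_toSeq_one (f : dirichletSpace α) :
    inner ℂ (toSeq α f) (toSeq α (one α)) = conj (coeff f 0) := by
  rw [← dinner_eq_inner_toSeq, dinner, tsum_eq_single 0 fun k hk => ?_]
  · rw [← coeff_taylor, taylor_one]
    simp
  · rw [← coeff_taylor, taylor_one, PowerSeries.coeff_one, if_neg hk, mul_zero, zero_mul]

theorem IsOptimalApproximant.eval_eq_zero_iff (hp : IsOptimalApproximant α f 1 p)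
    (hf : coeff f 0 ≠ 0) (hne : dinner α f (shift α f) ≠ 0) {z : ℂ} :
    p.eval z = 0 ↔ z = (dnorm α (shift α f) : ℂ) ^ 2 / dinner α f (shift α f) := by
  obtain ⟨b, a, rfl⟩ := Polynomial.exists_eq_X_add_C_of_natDegree_le_one hp.2.1
  have hmul : polynomialMultiple f (Polynomial.C b * Polynomial.X + Polynomial.C a) =
      b • toSeq α (shift α f) + a • toSeq α f := by
    simp [polynomialMultiple_apply, ← Algebra.smul_def]
  have h₀ : inner ℂ (toSeq α (shift α f)) (toSeq α (one α)) = 0 := by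
    rw [inner_toSeq_one, ← coeff_taylor, taylor_shift, PowerSeries.coeff_zero_X_mul, map_zero]
  have horth₁ : b * dnorm α (shift α f) ^ 2 + a * dinner α f (shift α f) = 0 := by
    have h := hp.inner_eq_zero (q := Polynomial.X) (by simp)
    rw [hmul, polynomialMultiple_apply, Polynomial.aeval_X, inner_sub_right, inner_add_right,
      inner_smul_right, inner_smul_right, h₀, zero_sub, neg_eq_zero,
      inner_self_eq_norm_sq_to_K] at h
    rwa [dnorm_eq_norm_toSeq, dinner_eq_inner_toSeq]
  have hb : b ≠ 0 := by
    rintro rfl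
    obtain rfl : a = 0 := by simpa [hne] using horth₁
    have h := hp.inner_eq_zero (q := 1) (by simp)
    rw [hmul, polynomialMultiple_apply, map_one, Module.End.one_apply, zero_smul, zero_smul,
      add_zero, sub_zero, inner_toSeq_one, _root_.map_eq_zero] at h
    exact hf h
  rw [Polynomial.eval_add, Polynomial.eval_mul, Polynomial.eval_C, Polynomial.eval_X,
    Polynomial.eval_C, eq_div_iff hne]
  constructor
  · intro h
    refine mul_left_cancel₀ hb ?_
    linear_combination dinner α f (shift α f) * h - horth₁
  · intro h
    refine (mul_eq_zero_iff_right hne).1 ?_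
    linear_combination b * h + horth₁

end OptimalApproximants

section BergmanExample

variable {a : ℝ}

theorem bergmanOneAddMulOneSubCpow_apply (ha : a < 1) (z : ℂ) :
    (bergmanOneAddMulOneSubCpow ha : ℂ → ℂ) z = (1 + z) / (1 - z) ^ (a : ℂ) := by
  rw [div_eq_mul_inv, ← Complex.cpow_neg, add_mul, one_mul]
  rfl

theorem isCyclic_bergmanOneAddMulOneSubCpow (h₀ : 0 < a) (ha : a < 1) :
    IsCyclic (-1) (bergmanOneAddMulOneSubCpow ha) := by
  have h := isCyclic_aeval_shift_oneSubCpow (α := -1) (a := a) (ζ := -1) (by norm_num)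
    (by rwa [Complex.ofReal_re]) (by rw [Complex.ofReal_re]; linarith) (by norm_num)
  simpa [bergmanOneAddMulOneSubCpow, bergmanOneSubCpow] using h

theorem coeff_bergmanOneAddMulOneSubCpow_zero (ha : a < 1) :
    coeff (bergmanOneAddMulOneSubCpow ha) 0 = 1 := by
  simp [coeff, bergmanOneAddMulOneSubCpow_apply]

theorem existsUnique_isOptimalApproximant_bergmanOneAddMulOneSubCpow (ha : a < 1) (n : ℕ) :
    ∃! p, IsOptimalApproximant (-1) (bergmanOneAddMulOneSubCpow ha) n p := by
  refine existsUnique_isOptimalApproximant (fun h => one_ne_zero (α := ℂ) ?_) n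
  rw [← coeff_bergmanOneAddMulOneSubCpow_zero ha, ← coeff_taylor, h, map_zero]

theorem IsOptimalApproximant.eval_eq_zero_iff_bergmanOneAddMulOneSubCpow (h₁ : 1 + a ≠ 0)
    (ha : a < 1) {p : Polynomial ℂ}
    (hp : IsOptimalApproximant (-1) (bergmanOneAddMulOneSubCpow ha) 1 p) {z : ℂ} :
    p.eval z = 0 ↔
      z = ((30 - 26 * a + 14 * a ^ 2 - 2 * a ^ 3) / (2 * (1 + a) * (3 - a) ^ 2) : ℝ) := by
  have hΓ : Real.Gamma (2 - 2 * a) ≠ 0 := (Real.Gamma_pos_of_pos (by linarith)).ne'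
  have hΓ₃ : Real.Gamma (3 - a) ≠ 0 := (Real.Gamma_pos_of_pos (by linarith)).ne'
  have h₃ : 3 - a ≠ 0 := by linarith
  have hcoeff : coeff (bergmanOneAddMulOneSubCpow ha) 0 ≠ 0 := by
    rw [coeff_bergmanOneAddMulOneSubCpow_zero]
    exact one_ne_zero
  have hinner : dinner (-1) (bergmanOneAddMulOneSubCpow ha)
      (shift (-1) (bergmanOneAddMulOneSubCpow ha)) ≠ 0 := by
    rw [dinner_bergmanOneAddMulOneSubCpow_shift, Complex.ofReal_ne_zero]
    positivity
  rw [hp.eval_eq_zero_iff hcoeff hinner, ← Complex.ofReal_pow,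
    dnorm_shift_bergmanOneAddMulOneSubCpow_sq, dinner_bergmanOneAddMulOneSubCpow_shift,
    ← Complex.ofReal_div, Gamma_four_sub h₃]
  have hquot : (30 - 26 * a + 14 * a ^ 2 - 2 * a ^ 3) *
        (Real.Gamma (2 - 2 * a) / ((3 - a) * Real.Gamma (3 - a)) ^ 2) /
      (2 * (1 + a) * (Real.Gamma (2 - 2 * a) / Real.Gamma (3 - a) ^ 2)) =
      (30 - 26 * a + 14 * a ^ 2 - 2 * a ^ 3) / (2 * (1 + a) * (3 - a) ^ 2) := by
    generalize Real.Gamma (2 - 2 * a) = Γ₂ at hΓ ⊢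
    field_simp
  rw [hquot]

theorem coe_bergmanOneAddMulOneSubCpow_four_fifths (ha : (4 / 5 : ℝ) < 1) :
    (bergmanOneAddMulOneSubCpow ha : ℂ → ℂ) = bergmanExample := by
  funext z
  rw [bergmanOneAddMulOneSubCpow_apply, bergmanExample]
  norm_num

theorem bergmanExample_ne_zero {z : ℂ} (hz : z ∈ Metric.ball (0 : ℂ) 1) :
    bergmanExample z ≠ 0 := by
  refine div_ne_zero ?_ (Complex.cpow_ne_zero_iff.2
    (.inl (Complex.slitPlane_ne_zero (one_sub_mem_slitPlane hz))))
  simpa using Complex.slitPlane_ne_zero (one_sub_mem_slitPlane (z := -z) (by simpa using hz))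

end BergmanExample

end DirichletType

end

theorem mainTheorem7 :
    DirichletType.IsCyclic (-1) DirichletType.bergmanExample ∧
    (fun z => z * DirichletType.bergmanExample z) ∈ DirichletType.space (-1) ∧
    DirichletType.dnorm (-1) (fun z => z * DirichletType.bergmanExample z) ^ 2 =
      2142 / 125 * (Real.Gamma (2 / 5) / Real.Gamma (16 / 5) ^ 2) ∧
    DirichletType.dinner (-1) DirichletType.bergmanExample
        (fun z => z * DirichletType.bergmanExample z) =
      ((9 * (Real.Gamma (7 / 5) / Real.Gamma (11 / 5) ^ 2) : ℝ) : ℂ) ∧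
    (∃ p : Polynomial ℂ,
      (∀ q : Polynomial ℂ,
        DirichletType.IsOptimalApproximant (-1) DirichletType.bergmanExample 1 q ↔ q = p) ∧
      {z : ℂ | p.eval z = 0} = {119 / 121}) ∧
    (119 / 121 : ℂ) ∈ Metric.ball (0 : ℂ) 1 ∧
    DirichletType.bergmanExample (119 / 121) ≠ 0 := by
  open DirichletType in
  have ha : (4 / 5 : ℝ) < 1 := by norm_num
  have hball : (119 / 121 : ℂ) ∈ Metric.ball (0 : ℂ) 1 := by
    rw [mem_ball_zero_iff]
    norm_num
  have hne := bergmanExample_ne_zero hball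
  rw [← coe_bergmanOneAddMulOneSubCpow_four_fifths ha] at hne ⊢
  refine ⟨isCyclic_bergmanOneAddMulOneSubCpow (by norm_num) ha,
    (shift (-1) (bergmanOneAddMulOneSubCpow ha)).2,
    (dnorm_shift_bergmanOneAddMulOneSubCpow_sq ha).trans (by norm_num),
    (dinner_bergmanOneAddMulOneSubCpow_shift ha).trans ?_, ?_, hball, hne⟩
  · have hΓ : Real.Gamma (7 / 5) = 2 / 5 * Real.Gamma (2 / 5) := by
      rw [← Real.Gamma_add_one (by norm_num)]
      norm_num
    rw [hΓ]
    norm_num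
    ring
  · obtain ⟨p, hp, huniq⟩ := existsUnique_isOptimalApproximant_bergmanOneAddMulOneSubCpow ha 1
    refine ⟨p, fun q => ⟨huniq q, fun h => h ▸ hp⟩, Set.ext fun z => ?_⟩
    refine (hp.eval_eq_zero_iff_bergmanOneAddMulOneSubCpow (by norm_num) ha).trans ?_
    norm_num
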